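/- Let $n, N \ge 0$ be integers, $[k]=\{1,\dots,k\}$, and put $0!!=1$, $1!!=0$, $k!!=(k-1)\,(k-2)!!$ for $k\ge 2$ (so $k!!$ is the number of perfect matchings of a $k$-element set). For $x\in[N]^n$ let $n_i(x)=|\{a\in[n] : x_a=i\}|$, and let $\Lambda^n=\{x\in[N]^n : n_i(x)\text{ is even for all } i\in[N]\}$, with the measure $\pi(x)=\prod_{i=1}^N (n_i(x)!!)^2$ and the norm $\|f\|_1=\sum_{x\in\Lambda^n}\pi(x)|f(x)|$ for $f:\Lambda^n\to\mathbb R$. For labels $a\ne b$ in $[n]$ and sites $i,j\in[N]$, let $m_{ab}^{ij}x$ be the configuration obtained from $x$ by moving particles $a$ and $b$ to site $j$ if $x_a=x_b=i$, and $m_{ab}^{ij}x=x$ otherwise; let $s_{ab}^{ij}x$ be the configuration obtained by exchanging the positions of particles $a$ and $b$ if $x_a=i$ and $x_b=j$, and $s_{ab}^{ij}x=x$ otherwise. For $i<j$ let $\mathcal L_{ij}=\mathcal M_{ij}-\mathcal E_{ij}$, where, with all sums over ordered pairs of distinct labels, $$\mathcal M_{ij}f(x)=\frac{n_j(x)+1}{n_i(x)-1}\sum_{a\neq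 b}\bigl(f(m_{ab}^{ij}x)-f(x)\bigr)+\frac{n_i(x)+1}{n_j(x)-1}\sum_{a\neq b}\bigl(f(m_{ab}^{ji}x)-f(x)\bigr),\qquad \mathcal E_{ij}f(x)=2\sum_{a\ne b}\bigl(f(s_{ab}^{ij}x)-f(x)\bigr).$$ Let $c_{ij}(s)\ge 0$ ($1\le i<j\le N$, $s\ge 0$) be any nonnegative time-dependent coefficients, let $\mathcal L_s=\sum_{i<j}c_{ij}(s)\mathcal L_{ij}$, and let $0\le s_1\le s_2$. The propagator (transition semigroup) $\mathcal U(s_1,s_2)$ of the colored eigenvector moment flow is the linear operator on functions $f:\Lambda^n\to\mathbb R$ with $\mathcal U(s_1,s_2)f=h_{s_2}$, where $h$ is continuous on $[s_1,s_2]$, $h_{s_1}=f$, and $\partial_s h_s=\mathcal L_s h_s$ for all $s\in(s_1,s_2)$. It exists and is unique if, for example, every $c_{ij}$ is continuous on $[s_1,s_2]$. Whenever the propagator exists, its operator norm from $L^1(\Lambda^n,\pi)$ to $L^1(\Lambda^n,\pi)$ satisfies, for every $N$, $$\|\mathcal U(s_1,s_2)\|_{1,1}=\sup_{\|f\|_1\le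 1}\|\mathcal U(s_1,s_2)f\|_1\le n!!.$$ -/

import Mathlib

open scoped ENNReal

namespace ColoredFlow

/-- The combinatorial double factorial `k!! = (k-1)(k-2)!!` with `0!! = 1` and `1!! = 0`:
the number of perfect matchings of a `k`-element set. -/
def matchings : ℕ → ℕ
  | 0 => 1
  | 1 => 0
  | k + 2 => (k + 1) * matchings k

/-- The particle number `n_i(x)`: the number of labels `a` with `x_a = i`. -/
def occ {n N : ℕ} (x : Fin n → Fin N) (i : Fin N) : ℕ :=
  (Finset.univ.filter (fun a => x a = i)).card

/-- The space of even configurations of `n` labelled particles on `N` sites. -/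
abbrev EvenConfig (n N : ℕ) : Type :=
  {x : Fin n → Fin N // ∀ i, Even (occ x i)}

/-- The two particle jump: particles `a ≠ b`, if both are at site `i`, move to site `j`.
In all other cases (and by convention for `a = b`) nothing happens. -/
def jumpFun {n N : ℕ} (a b : Fin n) (i j : Fin N) (x : Fin n → Fin N) : Fin n → Fin N :=
  fun c => if (c = a ∨ c = b) ∧ (a ≠ b ∧ x a = i ∧ x b = i) then j else x c

/-- The two particle swap: if particle `a` is at site `i` and particle `b` is at site `j`,
they exchange their positions. In all other cases nothing happens. -/
def swapFun {n N : ℕ} (a b : Fin n) (i j : Fin N) (x : Fin n → Fin N) : Fin n → Fin N :=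
  fun c => if c = a ∧ (x a = i ∧ x b = j) then j
    else if c = b ∧ (x a = i ∧ x b = j) then i else x c

theorem occ_eq_sum {n N : ℕ} (x : Fin n → Fin N) (i : Fin N) {a b : Fin n} (hab : a ≠ b) :
    occ x i = (if x a = i then 1 else 0) + ((if x b = i then 1 else 0) +
      ∑ c ∈ (Finset.univ.erase a).erase b, if x c = i then 1 else 0) := by
  rw [Finset.add_sum_erase (Finset.univ.erase a) (fun c => if x c = i then 1 else 0)
      (by simp [hab.symm]),
    Finset.add_sum_erase Finset.univ (fun c => if x c = i then 1 else 0) (Finset.mem_univ a)]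
  simp [occ]

theorem jumpFun_even {n N : ℕ} (a b : Fin n) (i j : Fin N) (x : Fin n → Fin N)
    (hx : ∀ k, Even (occ x k)) (k : Fin N) : Even (occ (jumpFun a b i j x) k) := by
  by_cases h : a ≠ b ∧ x a = i ∧ x b = i
  · have hk := hx k
    have hR : ∑ c ∈ (Finset.univ.erase a).erase b, (if jumpFun a b i j x c = k then 1 else 0)
        = ∑ c ∈ (Finset.univ.erase a).erase b, (if x c = k then 1 else 0) := by
      refine Finset.sum_congr rfl fun c hc => ?_
      simp only [Finset.mem_erase] at hc
      simp [jumpFun, hc.1, hc.2.1]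
    rw [occ_eq_sum _ k h.1] at hk ⊢
    rw [hR]
    have ha : jumpFun a b i j x a = j := by simp [jumpFun, h]
    have hb : jumpFun a b i j x b = j := by simp [jumpFun, h]
    rw [ha, hb]
    rw [h.2.1, h.2.2] at hk
    rw [← add_assoc, ← two_mul] at hk ⊢
    rw [Nat.even_add] at hk ⊢
    simp only [even_two_mul, true_iff] at hk ⊢
    exact hk
  · have : jumpFun a b i j x = x := by
      funext c
      simp only [jumpFun, h, and_false, if_false]
    rw [this]
    exact hx k

theorem swapFun_even {n N : ℕ} (a b : Fin n) (i j : Fin N) (x : Fin n → Fin N)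
    (hx : ∀ k, Even (occ x k)) (k : Fin N) : Even (occ (swapFun a b i j x) k) := by
  by_cases h : x a = i ∧ x b = j
  · by_cases hab : a = b
    · have : swapFun a b i j x = x := by
        funext c
        subst hab
        by_cases hc : c = a
        · subst hc
          have hij : i = j := h.1.symm.trans h.2
          simp [swapFun, h, hij]
        · simp [swapFun, hc]
      rw [this]
      exact hx k
    · have hk := hx k
      have hR : ∑ c ∈ (Finset.univ.erase a).erase b, (if swapFun a b i j x c = k then 1 else 0)
          = ∑ c ∈ (Finset.univ.erase a).erase b, (if x c = k then 1 else 0) := by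
        refine Finset.sum_congr rfl fun c hc => ?_
        simp only [Finset.mem_erase] at hc
        simp [swapFun, hc.1, hc.2.1]
      rw [occ_eq_sum _ k hab] at hk ⊢
      rw [hR]
      have ha : swapFun a b i j x a = j := by simp [swapFun, h]
      have hb : swapFun a b i j x b = i := by simp [swapFun, h, Ne.symm hab]
      rw [ha, hb]
      rw [h.1, h.2] at hk
      rwa [add_left_comm]
  · have : swapFun a b i j x = x := by
      funext c
      simp only [swapFun, h, and_false, if_false]
    rw [this]
    exact hx k

/-- The jump operator `m_{ab}^{ij}` on even configurations. -/
def jump {n N : ℕ} (a b : Fin n) (i j : Fin N) (x : EvenConfig n N) : EvenConfig n N :=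
  ⟨jumpFun a b i j x.1, jumpFun_even a b i j x.1 x.2⟩

/-- The swap operator `s_{ab}^{ij}` on even configurations. -/
def swap {n N : ℕ} (a b : Fin n) (i j : Fin N) (x : EvenConfig n N) : EvenConfig n N :=
  ⟨swapFun a b i j x.1, swapFun_even a b i j x.1 x.2⟩

noncomputable section

/-- The move operator `M_{ij}`; the sums run over ordered pairs of distinct labels. A summand with
`n_i(x) = 0` (where the prefactor is negative) vanishes, as then no jump away from `i` occurs. -/
def moveOp {n N : ℕ} (i j : Fin N) (f : EvenConfig n N → ℝ) (x : EvenConfig n N) : ℝ :=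
  ((occ x.1 j : ℝ) + 1) / ((occ x.1 i : ℝ) - 1) *
      ∑ p ∈ (Finset.univ : Finset (Fin n)).offDiag, (f (jump p.1 p.2 i j x) - f x) +
    ((occ x.1 i : ℝ) + 1) / ((occ x.1 j : ℝ) - 1) *
      ∑ p ∈ (Finset.univ : Finset (Fin n)).offDiag, (f (jump p.1 p.2 j i x) - f x)

/-- The exchange operator `E_{ij}`; the sum runs over ordered pairs of distinct labels. -/
def exchOp {n N : ℕ} (i j : Fin N) (f : EvenConfig n N → ℝ) (x : EvenConfig n N) : ℝ :=
  2 * ∑ p ∈ (Finset.univ : Finset (Fin n)).offDiag, (f (swap p.1 p.2 i j x) - f x)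

/-- The generator `∑_{i<j} c_{ij} (M_{ij} - E_{ij})` of the colored eigenvector moment flow, for
given values `c_{ij}` of the coefficients. -/
def generator {n N : ℕ} (c : Fin N → Fin N → ℝ) (f : EvenConfig n N → ℝ) :
    EvenConfig n N → ℝ :=
  fun x => ∑ i : Fin N, ∑ j ∈ Finset.univ.filter (fun j => i < j),
    c i j * (moveOp i j f x - exchOp i j f x)

/-- The reversible measure `π(x) = ∏_i (n_i(x)!!)²`. -/
def revMeasure {n N : ℕ} (x : EvenConfig n N) : ℝ :=
  ∏ i : Fin N, (matchings (occ x.1 i) : ℝ) ^ 2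

/-- The `L¹` norm with respect to the reversible measure. -/
def normL1 {n N : ℕ} (f : EvenConfig n N → ℝ) : ℝ :=
  ∑ x : EvenConfig n N, revMeasure x * |f x|

/-- The `L¹ → L¹` operator norm: the supremum of `‖U f‖₁` over the unit ball `‖f‖₁ ≤ 1`. -/
def opNormL1 {n N : ℕ} (U : (EvenConfig n N → ℝ) →ₗ[ℝ] (EvenConfig n N → ℝ)) : ℝ≥0∞ :=
  ⨆ (f : EvenConfig n N → ℝ) (_ : normL1 f ≤ 1), ENNReal.ofReal (normL1 (U f))

/-- `h` solves the flow `∂_s h_s = L_s h_s` at all times `s ∈ (s₁, s₂)`, where `L_s` has the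
coefficients `c_{ij}(s)`; it is continuous up to the end points and starts from `h_{s₁} = f`. -/
structure IsFlowSolution {n N : ℕ} (c : Fin N → Fin N → ℝ → ℝ) (s₁ s₂ : ℝ)
    (f : EvenConfig n N → ℝ) (h : ℝ → EvenConfig n N → ℝ) : Prop where
  continuousOn : ∀ x, ContinuousOn (fun s => h s x) (Set.Icc s₁ s₂)
  initial : h s₁ = f
  hasDerivAt : ∀ s ∈ Set.Ioo s₁ s₂, ∀ x,
    HasDerivAt (fun r => h r x) (generator (fun i j => c i j s) (h s) x) s

/-- `U` is the propagator from time `s₁` to time `s₂`: it maps every initial function `f` to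
the value `h_{s₂}` of the solution `h` of the flow with `h_{s₁} = f`. -/
def IsPropagator {n N : ℕ} (c : Fin N → Fin N → ℝ → ℝ) (s₁ s₂ : ℝ)
    (U : (EvenConfig n N → ℝ) →ₗ[ℝ] (EvenConfig n N → ℝ)) : Prop :=
  ∀ f, ∃ h : ℝ → EvenConfig n N → ℝ, IsFlowSolution c s₁ s₂ f h ∧ U f = h s₂

end

end ColoredFlow

/-! Multiply `f` by `∏ n_i!!`, the square root of `π`, and extend by zero to a tensor `F` on all of
`[N]^n`. In these coordinates `L_ij` becomes `X_ij²`, where `X_ij` is the infinitesimal rotation of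
the sites `i`, `j` acting on `n`-tensors (`rotGen_rotGen_lift`). The flow is thus a heat flow along
rotations. For any fixed tensor `W`, the maximum of `⟨W, O^{⊗n} F_s⟩` over orthogonal `O` cannot
increase in `s`, since second derivatives along rotations are nonpositive at a maximum
(`IsFlowSolution.rotPairing_le`).

At time `s₂`, the choice `O = 1` and `W = ∏ n_i!! · sign F_{s₂}` turns the pairing into `‖h_{s₂}‖₁`.
At time `s₁`, `|W|` is at most the number of matchings within sites. The coefficient of each `|F y|`
therefore expands over the perfect matchings of the labels, every matched pair contributing an inner
product of two columns of `|O|`, at most `1` by Cauchy-Schwarz (`sum_siteMatchings_mul_prod_le`).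
The total is at most `n!! ∑ |F| ≤ n!! ‖f‖₁`, as `∏ n_i!! ≥ 1` on even configurations.

Applied to a difference of solutions, the same bound gives uniqueness. -/

namespace ColoredFlow

/-! ### Matchings within sites and the Wick bound -/

/-- The number `∏ n_i(x)!!` of perfect matchings of the labels which only match labels at the
same site. -/
def siteMatchings {n N : ℕ} (x : Fin n → Fin N) : ℕ := ∏ k, matchings (occ x k)

theorem matchings_add_one (m : ℕ) : matchings (m + 1) = m * matchings (m - 1) := by
  cases m <;> simp [matchings]

theorem occ_cons {n N : ℕ} (i : Fin N) (z : Fin n → Fin N) (k : Fin N) :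
    occ (Fin.cons i z : Fin (n + 1) → Fin N) k = (if i = k then 1 else 0) + occ z k := by
  simp only [occ, Finset.card_filter, Fin.sum_univ_succ, Fin.cons_zero, Fin.cons_succ]

theorem occ_removeNth {n N : ℕ} (b : Fin (n + 1)) (z : Fin (n + 1) → Fin N) (k : Fin N) :
    occ z k = (if z b = k then 1 else 0) + occ (b.removeNth z) k := by
  rw [occ, occ, Finset.card_filter, Finset.card_filter, Fin.sum_univ_succAbove _ b]
  rfl

/-- Expansion over the partner of the first label. -/
theorem siteMatchings_cons {n N : ℕ} (i : Fin N) (z : Fin (n + 1) → Fin N) :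
    siteMatchings (Fin.cons i z : Fin (n + 2) → Fin N) =
      ∑ b, if z b = i then siteMatchings (b.removeNth z) else 0 := by
  -- All `occ z i` possible partners contribute the same amount, since only the occupation numbers
  -- matter.
  have hb : ∀ b, z b = i → siteMatchings (b.removeNth z) =
      matchings (occ z i - 1) * ∏ k ∈ Finset.univ.erase i, matchings (occ z k) := by
    intro b hb
    rw [siteMatchings, ← Finset.mul_prod_erase _ _ (Finset.mem_univ i), occ_removeNth b z i]
    congr 1
    · simp [hb]
    · refine Finset.prod_congr rfl fun k hk => ?_
      rw [occ_removeNth b z k, if_neg (by simp at hk; rw [hb]; exact Ne.symm hk), zero_add]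
  rw [Finset.sum_congr rfl (g := fun b => if z b = i then matchings (occ z i - 1) *
    ∏ k ∈ Finset.univ.erase i, matchings (occ z k) else 0)
    (fun b _ => by split_ifs with h; exacts [hb b h, rfl])]
  rw [← Finset.sum_filter, Finset.sum_const, smul_eq_mul, siteMatchings,
    ← Finset.mul_prod_erase _ _ (Finset.mem_univ i), occ_cons, if_pos rfl, add_comm 1,
    matchings_add_one, mul_assoc]
  change _ * (_ * _) = occ z i * _
  congr 2
  refine Finset.prod_congr rfl fun k hk => ?_
  rw [occ_cons, if_neg (by simp at hk; exact Ne.symm hk), zero_add]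

theorem sum_mul_le_one {ι : Type*} [Fintype ι] {u v : ι → ℝ} (hu : ∑ i, u i ^ 2 ≤ 1)
    (hv : ∑ i, v i ^ 2 ≤ 1) : ∑ i, u i * v i ≤ 1 := by
  have h : ∑ i, u i * v i ≤ ∑ i, (u i ^ 2 + v i ^ 2) / 2 :=
    Finset.sum_le_sum fun i _ => by nlinarith [sq_nonneg (u i - v i)]
  rw [← Finset.sum_div, Finset.sum_add_distrib] at h
  linarith

/-- A Wick type bound: expanding over matchings and using the Cauchy-Schwarz inequality for each
matched pair. -/
theorem sum_siteMatchings_mul_prod_le {N : ℕ} : ∀ (n : ℕ) (v : Fin n → Fin N → ℝ),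
    (∀ a i, 0 ≤ v a i) → (∀ a, ∑ i, v a i ^ 2 ≤ 1) →
    ∑ x : Fin n → Fin N, (siteMatchings x : ℝ) * ∏ a, v a (x a) ≤ matchings n
  | 0, v, _, _ => by simp [siteMatchings, matchings, occ]
  | 1, v, _, _ => by
      have h : ∀ x : Fin 1 → Fin N, siteMatchings x = 0 := fun x =>
        Finset.prod_eq_zero (Finset.mem_univ (x 0)) (by
          have : occ x (x 0) = 1 := by
            simp only [occ, Finset.card_filter, Fin.sum_univ_one, if_true]
          rw [this]; rfl)
      simp [h]
  | n + 2, v, h0, h1 => by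
      -- The first label and its partner `b.succ` share a site, so summing over that site gives an
      -- inner product, and the other `n` labels form a sum of the same kind.
      have key : ∑ x : Fin (n + 2) → Fin N, (siteMatchings x : ℝ) * ∏ a, v a (x a) =
          ∑ b : Fin (n + 1), (∑ i, v 0 i * v b.succ i) *
            ∑ t : Fin n → Fin N, (siteMatchings t : ℝ) * ∏ a, v (b.succAbove a).succ (t a) := by
        rw [← (Fin.consEquiv (fun _ : Fin (n + 2) => Fin N)).sum_comp, Fintype.sum_prod_type]
        have e1 : ∀ (i : Fin N) (z : Fin (n + 1) → Fin N),
            (siteMatchings (Fin.consEquiv (fun _ : Fin (n + 2) => Fin N) (i, z)) : ℝ) *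
              ∏ a, v a (Fin.consEquiv (fun _ : Fin (n + 2) => Fin N) (i, z) a) =
            ∑ b, if z b = i then (siteMatchings (b.removeNth z) : ℝ) *
              (v 0 i * ∏ a, v a.succ (z a)) else 0 := by
          intro i z
          have : siteMatchings (Fin.consEquiv (fun _ : Fin (n + 2) => Fin N) (i, z)) = _ :=
            siteMatchings_cons i z
          rw [this, Nat.cast_sum, Finset.sum_mul]
          refine Finset.sum_congr rfl fun b _ => ?_
          rw [Fin.prod_univ_succ]
          split_ifs <;> simp [Fin.consEquiv]
        simp_rw [e1]
        rw [Finset.sum_congr rfl fun i _ => Finset.sum_comm, Finset.sum_comm]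
        refine Finset.sum_congr rfl fun b _ => ?_
        rw [Finset.sum_mul]
        refine Finset.sum_congr rfl fun i _ => ?_
        rw [← (Fin.insertNthEquiv (fun _ : Fin (n + 1) => Fin N) b).sum_comp,
          Fintype.sum_prod_type]
        simp only [Fin.insertNthEquiv_apply, Fin.insertNth_apply_same,
          Fin.prod_univ_succAbove _ b, Fin.insertNth_apply_succAbove]
        rw [Finset.sum_eq_single i (fun j _ hj => by simp [hj]) (by simp), Finset.mul_sum]
        refine Finset.sum_congr rfl fun t _ => ?_
        have ht : b.removeNth (Fin.insertNthEquiv (fun _ : Fin (n + 1) => Fin N) b (i, t)) = t :=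
          Fin.removeNth_insertNth (α := fun _ => Fin N) b i t
        rw [if_pos rfl, ht]
        ring
      rw [key]
      have hb : ∀ b : Fin (n + 1), (∑ i, v 0 i * v b.succ i) *
          ∑ t : Fin n → Fin N, (siteMatchings t : ℝ) * ∏ a, v (b.succAbove a).succ (t a) ≤
          matchings n := by
        intro b
        have h2 := sum_siteMatchings_mul_prod_le n (fun a => v (b.succAbove a).succ)
          (fun a i => h0 _ i) (fun a => h1 _)
        have h3 : 0 ≤ ∑ t : Fin n → Fin N,
            (siteMatchings t : ℝ) * ∏ a, v (b.succAbove a).succ (t a) :=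
          Finset.sum_nonneg fun t _ => mul_nonneg (Nat.cast_nonneg _)
            (Finset.prod_nonneg fun a _ => h0 _ _)
        calc _ ≤ 1 * _ := mul_le_mul_of_nonneg_right (sum_mul_le_one (h1 0) (h1 _)) h3
          _ ≤ _ := by simpa using h2
      refine (Finset.sum_le_sum fun b _ => hb b).trans (le_of_eq ?_)
      simp [matchings]

/-! ### Infinitesimal rotations and orthogonal matrices -/

/-- The nonzero entries of the infinitesimal rotation of the sites `i` and `j`. -/
def rotSign {N : ℕ} (i j k : Fin N) : ℝ := if k = i then 1 else if k = j then -1 else 0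

/-- Particle `a` is moved to the other site if it is at one of the sites `i` and `j`. -/
def flipAt {n N : ℕ} (i j : Fin N) (a : Fin n) (y : Fin n → Fin N) : Fin n → Fin N :=
  Function.update y a (Equiv.swap i j (y a))

/-- The infinitesimal rotation of the sites `i` and `j`, acting on `n`-tensors. -/
def rotGen {n N : ℕ} (i j : Fin N) (G : (Fin n → Fin N) → ℝ) (y : Fin n → Fin N) : ℝ :=
  ∑ a, rotSign i j (y a) * G (flipAt i j a y)

theorem rotSign_swap {N : ℕ} {i j : Fin N} (hij : i ≠ j) (k : Fin N) :
    rotSign i j (Equiv.swap i j k) = -rotSign i j k := by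
  unfold rotSign
  rw [Equiv.swap_apply_def]
  split_ifs <;> simp_all

theorem flipAt_flipAt {n N : ℕ} (i j : Fin N) (a : Fin n) (y : Fin n → Fin N) :
    flipAt i j a (flipAt i j a y) = y := by
  simp [flipAt]

/-- Integration by parts: `flipAt` is an involution under which the coefficient `rotSign` changes
sign. -/
theorem sum_rotGen_mul {n N : ℕ} {i j : Fin N} (hij : i ≠ j) (G F : (Fin n → Fin N) → ℝ) :
    ∑ y, rotGen i j G y * F y = -∑ y, G y * rotGen i j F y := by
  simp only [rotGen, Finset.sum_mul, Finset.mul_sum, ← Finset.sum_neg_distrib]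
  rw [Finset.sum_comm]
  nth_rw 2 [Finset.sum_comm]
  refine Finset.sum_congr rfl fun a _ => ?_
  have hinv : Function.Involutive (flipAt i j a) := flipAt_flipAt i j a
  rw [← Equiv.sum_comp (hinv.toPerm (flipAt i j a))]
  refine Finset.sum_congr rfl fun y _ => ?_
  have h : flipAt i j a y a = Equiv.swap i j (y a) := by simp [flipAt]
  simp only [Function.Involutive.coe_toPerm, flipAt_flipAt, h, rotSign_swap hij]
  ring

/-- The rotation by the angle `θ` of the columns `i` and `j` of `O`. -/
noncomputable def rotate {N : ℕ} (i j : Fin N) (θ : ℝ) (O : Fin N → Fin N → ℝ) :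
    Fin N → Fin N → ℝ := fun r k =>
  if k = i then Real.cos θ * O r i + Real.sin θ * O r j
  else if k = j then -Real.sin θ * O r i + Real.cos θ * O r j else O r k

theorem rotate_zero {N : ℕ} (i j : Fin N) (O : Fin N → Fin N → ℝ) : rotate i j 0 O = O := by
  funext r k
  simp only [rotate, Real.cos_zero, Real.sin_zero]
  split_ifs <;> simp_all

theorem hasDerivAt_rotate {N : ℕ} {i j : Fin N} (hij : i ≠ j) (O : Fin N → Fin N → ℝ) (r k : Fin N)
    (θ : ℝ) : HasDerivAt (fun t => rotate i j t O r k)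
      (rotSign i j k * rotate i j θ O r (Equiv.swap i j k)) θ := by
  have hc := Real.hasDerivAt_cos θ
  have hs := Real.hasDerivAt_sin θ
  by_cases hi : k = i
  · subst hi
    simp only [rotate, rotSign, Equiv.swap_apply_left, if_true, if_neg hij.symm, one_mul]
    exact (hc.mul_const _).add (hs.mul_const _)
  by_cases hj : k = j
  · subst hj
    simp only [rotate, rotSign, Equiv.swap_apply_right, if_true, if_neg hij.symm]
    refine ((hs.neg.mul_const _).add (hc.mul_const _)).congr_deriv ?_
    ring
  · simp only [rotate, rotSign, if_neg hi, if_neg hj, zero_mul]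
    exact hasDerivAt_const _ _

/-- The matrices with orthonormal columns. -/
def orthonormalColumns (N : ℕ) : Set (Fin N → Fin N → ℝ) :=
  {O | ∀ k l, ∑ r, O r k * O r l = if k = l then 1 else 0}

theorem rotate_mem {N : ℕ} {i j : Fin N} (hij : i ≠ j) (θ : ℝ) {O : Fin N → Fin N → ℝ}
    (hO : O ∈ orthonormalColumns N) : rotate i j θ O ∈ orthonormalColumns N := by
  -- Each new column is a combination of the columns `i`, `j` and itself with coefficients `p`, `q`,
  -- `m`, so the Gram matrix expands bilinearly.
  set p : Fin N → ℝ := fun k =>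
    if k = i then Real.cos θ else if k = j then -Real.sin θ else 0 with hp
  set q : Fin N → ℝ := fun k =>
    if k = i then Real.sin θ else if k = j then Real.cos θ else 0 with hq
  set m : Fin N → ℝ := fun k => if k = i then 0 else if k = j then 0 else 1 with hm
  have hrot : ∀ r k, rotate i j θ O r k = p k * O r i + q k * O r j + m k * O r k := by
    intro r k
    simp only [rotate, hp, hq, hm]
    split_ifs <;> ring
  have hsum : ∀ k l, ∑ r, rotate i j θ O r k * rotate i j θ O r l =
      p k * p l + q k * q l + m k * m l * (if k = l then 1 else 0) +
      p k * m l * (if i = l then 1 else 0) + q k * m l * (if j = l then 1 else 0) +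
      m k * p l * (if k = i then 1 else 0) + m k * q l * (if k = j then 1 else 0) := by
    intro k l
    have hii : (1 : ℝ) = ∑ r, O r i * O r i := by rw [hO i i, if_pos rfl]
    have hjj : (1 : ℝ) = ∑ r, O r j * O r j := by rw [hO j j, if_pos rfl]
    have hij0 : ∑ r, O r i * O r j = 0 := by rw [hO i j, if_neg hij]
    have e : ∀ r, rotate i j θ O r k * rotate i j θ O r l =
        p k * p l * (O r i * O r i) + q k * q l * (O r j * O r j) + m k * m l * (O r k * O r l) +
        p k * m l * (O r i * O r l) + q k * m l * (O r j * O r l) +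
        m k * p l * (O r k * O r i) + m k * q l * (O r k * O r j) +
        (p k * q l + q k * p l) * (O r i * O r j) := fun r => by
      rw [hrot, hrot]
      ring
    simp only [e, Finset.sum_add_distrib, ← Finset.mul_sum]
    rw [← hii, ← hjj, hij0, hO, hO, hO, hO, hO]
    ring
  intro k l
  rw [hsum]
  have hcs := Real.cos_sq_add_sin_sq θ
  simp only [hp, hq, hm]
  clear hsum hrot hp hq hm hO
  clear p q m
  split_ifs <;> first | linear_combination hcs | ring1 | grind

theorem abs_le_one_of_mem {N : ℕ} {O : Fin N → Fin N → ℝ} (hO : O ∈ orthonormalColumns N)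
    (r k : Fin N) : |O r k| ≤ 1 := by
  have h := hO k k
  rw [if_pos rfl] at h
  have := Finset.single_le_sum (f := fun r => O r k * O r k) (fun r _ => mul_self_nonneg _)
    (Finset.mem_univ r)
  rw [← sq_le_one_iff_abs_le_one]
  nlinarith

theorem isCompact_orthonormalColumns (N : ℕ) : IsCompact (orthonormalColumns N) := by
  refine Metric.isCompact_of_isClosed_isBounded ?_ ?_
  · simp only [orthonormalColumns, Set.ofPred_forall]
    refine isClosed_iInter fun k => isClosed_iInter fun l => isClosed_eq ?_ continuous_const
    fun_prop
  · refine (Metric.isBounded_closedBall (x := 0) (r := 1)).subset fun O hO => ?_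
    rw [mem_closedBall_zero_iff, pi_norm_le_iff_of_nonneg zero_le_one]
    intro r
    rw [pi_norm_le_iff_of_nonneg zero_le_one]
    exact fun k => abs_le_one_of_mem hO r k

/-! ### The pairing and its derivatives along rotations -/

/-- The pairing of the tensor `W` with the tensor `F`, rotated by `O`. -/
def rotPairing {n N : ℕ} (W F : (Fin n → Fin N) → ℝ) (O : Fin N → Fin N → ℝ) : ℝ :=
  ∑ x, W x * ∑ y, (∏ a, O (x a) (y a)) * F y

/-- By the Leibniz rule, differentiating the factor of label `a` moves `y a` to the other site, with
a sign; this is the term `a` of `rotGen`. -/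
theorem hasDerivAt_prod_rotate {n N : ℕ} {i j : Fin N} (hij : i ≠ j) (O : Fin N → Fin N → ℝ)
    (x y : Fin n → Fin N) (θ : ℝ) :
    HasDerivAt (fun t => ∏ a, rotate i j t O (x a) (y a))
      (rotGen i j (fun z => ∏ a, rotate i j θ O (x a) (z a)) y) θ := by
  refine (HasDerivAt.fun_finsetProd (u := Finset.univ)
    fun a _ => hasDerivAt_rotate hij O (x a) (y a) θ).congr_deriv ?_
  refine Finset.sum_congr rfl fun a _ => ?_
  beta_reduce
  rw [← Finset.mul_prod_erase _ _ (Finset.mem_univ a), smul_eq_mul]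
  have h : ∏ b ∈ Finset.univ.erase a, rotate i j θ O (x b) (flipAt i j a y b) =
      ∏ b ∈ Finset.univ.erase a, rotate i j θ O (x b) (y b) :=
    Finset.prod_congr rfl fun b hb => by
      rw [flipAt, Function.update_of_ne (Finset.ne_of_mem_erase hb)]
  rw [h, flipAt, Function.update_self]
  ring

theorem hasDerivAt_rotPairing {n N : ℕ} {i j : Fin N} (hij : i ≠ j)
    (W F : (Fin n → Fin N) → ℝ) (O : Fin N → Fin N → ℝ) (θ : ℝ) :
    HasDerivAt (fun t => rotPairing W F (rotate i j t O))
      (-rotPairing W (rotGen i j F) (rotate i j θ O)) θ := by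
  have h : HasDerivAt (fun t => rotPairing W F (rotate i j t O))
      (∑ x, W x * ∑ y, rotGen i j (fun z => ∏ a, rotate i j θ O (x a) (z a)) y * F y) θ :=
    HasDerivAt.fun_sum fun x _ => (HasDerivAt.fun_sum fun y _ =>
      (hasDerivAt_prod_rotate hij O x y θ).mul_const _).const_mul _
  refine h.congr_deriv ?_
  simp only [sum_rotGen_mul hij, rotPairing, mul_neg, Finset.sum_neg_distrib]

/-- The second derivative in the direction of a rotation is nonpositive at a maximum. -/
theorem rotPairing_rotGen_rotGen_nonpos {n N : ℕ} {i j : Fin N} (hij : i ≠ j)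
    {W F : (Fin n → Fin N) → ℝ} {O : Fin N → Fin N → ℝ} (hO : O ∈ orthonormalColumns N)
    (hmax : ∀ O' ∈ orthonormalColumns N, rotPairing W F O' ≤ rotPairing W F O) :
    rotPairing W (rotGen i j (rotGen i j F)) O ≤ 0 := by
  set g : ℝ → ℝ := fun t => rotPairing W F (rotate i j t O) with hg
  have h1 : deriv g = fun θ => -rotPairing W (rotGen i j F) (rotate i j θ O) :=
    funext fun θ => (hasDerivAt_rotPairing hij W F O θ).deriv
  -- Each derivative brings a minus sign from the integration by parts; the two cancel.
  have h2 : deriv (deriv g) 0 = rotPairing W (rotGen i j (rotGen i j F)) O := by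
    rw [h1]
    have := (hasDerivAt_rotPairing hij W (rotGen i j F) O 0).fun_neg.deriv
    rwa [neg_neg, rotate_zero] at this
  have hm : IsLocalMax g 0 := Filter.Eventually.of_forall fun t => by
    simp only [hg, rotate_zero]
    exact hmax _ (rotate_mem hij t hO)
  by_contra hneg
  rw [not_le, ← h2] at hneg
  -- A positive second derivative would make `0` a local minimum as well, so `g` would be locally
  -- constant with vanishing second derivative.
  have hmin : IsLocalMin g 0 := isLocalMin_of_deriv_deriv_pos hneg hm.deriv_eq_zero
    (hasDerivAt_rotPairing hij W F O 0).continuousAt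
  have hconst : g =ᶠ[nhds 0] fun _ => g 0 := by
    filter_upwards [hm, hmin] with t ht ht' using le_antisymm ht ht'
  have h0 : deriv g =ᶠ[nhds 0] fun _ => 0 := by
    filter_upwards [hconst.deriv] with t ht using ht.trans (deriv_const _ _)
  rw [h0.deriv_eq, deriv_const] at hneg
  exact lt_irrefl _ hneg

theorem rotPairing_sum {n N : ℕ} {ι : Type*} (s : Finset ι) (W : (Fin n → Fin N) → ℝ)
    (c : ι → ℝ) (F : ι → (Fin n → Fin N) → ℝ) (O : Fin N → Fin N → ℝ) :
    rotPairing W (fun y => ∑ k ∈ s, c k * F k y) O = ∑ k ∈ s, c k * rotPairing W (F k) O := by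
  simp only [rotPairing, Finset.mul_sum]
  rw [Finset.sum_comm (s := s)]
  refine Finset.sum_congr rfl fun x _ => ?_
  rw [Finset.sum_comm (s := s)]
  exact Finset.sum_congr rfl fun y _ => Finset.sum_congr rfl fun k _ => by ring

theorem rotPairing_one {n N : ℕ} (W F : (Fin n → Fin N) → ℝ) :
    rotPairing W F (fun r k => if r = k then 1 else 0) = ∑ x, W x * F x := by
  refine Finset.sum_congr rfl fun x _ => ?_
  rw [Finset.sum_eq_single x (fun y _ hy => ?_) (by simp)]
  · simp
  · obtain ⟨a, ha⟩ := Function.ne_iff.1 hy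
    rw [Finset.prod_eq_zero (Finset.mem_univ a) (if_neg ha.symm), zero_mul]

theorem rotPairing_le {n N : ℕ} {W F : (Fin n → Fin N) → ℝ}
    (hW : ∀ x, |W x| ≤ siteMatchings x) {O : Fin N → Fin N → ℝ}
    (hO : O ∈ orthonormalColumns N) :
    rotPairing W F O ≤ matchings n * ∑ y, |F y| := by
  calc rotPairing W F O
      ≤ ∑ x, ∑ y, ((siteMatchings x : ℝ) * ∏ a, |O (x a) (y a)|) * |F y| := by
        refine Finset.sum_le_sum fun x _ => ?_
        rw [Finset.mul_sum]
        refine Finset.sum_le_sum fun y _ => (le_abs_self _).trans ?_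
        rw [← mul_assoc, abs_mul, abs_mul, Finset.abs_prod]
        gcongr
        exact hW x
    _ = ∑ y, (∑ x, (siteMatchings x : ℝ) * ∏ a, |O (x a) (y a)|) * |F y| := by
        rw [Finset.sum_comm]
        simp only [Finset.sum_mul]
    _ ≤ ∑ y, (matchings n : ℝ) * |F y| := by
        refine Finset.sum_le_sum fun y _ => mul_le_mul_of_nonneg_right ?_ (abs_nonneg _)
        -- For fixed `y`, the vector attached to label `a` is column `y a` of `|O|`, a unit vector.
        refine sum_siteMatchings_mul_prod_le n (fun a r => |O r (y a)|)
          (fun _ _ => abs_nonneg _) fun a => ?_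
        simp only [sq_abs]
        simp only [sq]
        rw [hO, if_pos rfl]
    _ = _ := (Finset.mul_sum _ _ _).symm

/-! ### The generator as the square of a rotation -/

theorem flipAt_comm_sites {n N : ℕ} (i j : Fin N) (a : Fin n) (y : Fin n → Fin N) :
    flipAt i j a y = flipAt j i a y := by
  rw [flipAt, flipAt, Equiv.swap_comm]

theorem flipAt_comm {n N : ℕ} (i j : Fin N) {a b : Fin n} (hab : a ≠ b) (y : Fin n → Fin N) :
    flipAt i j b (flipAt i j a y) = flipAt i j a (flipAt i j b y) := by
  simp only [flipAt, Function.update_of_ne hab, Function.update_of_ne hab.symm]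
  exact Function.update_comm hab _ _ _

theorem flipAt_flipAt_eq_jumpFun {n N : ℕ} {i : Fin N} (j : Fin N) {a b : Fin n} (hab : a ≠ b)
    {y : Fin n → Fin N} (ha : y a = i) (hb : y b = i) :
    flipAt i j b (flipAt i j a y) = jumpFun a b i j y := by
  funext c
  simp only [flipAt, jumpFun, Function.update_apply, ha, hb]
  by_cases hcb : c = b
  · simp [hcb, hab, hab.symm]
  · by_cases hca : c = a <;> simp [hca, hcb, hab]

theorem flipAt_flipAt_eq_swapFun {n N : ℕ} {i j : Fin N} {a b : Fin n} (hab : a ≠ b)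
    {y : Fin n → Fin N} (ha : y a = i) (hb : y b = j) :
    flipAt i j b (flipAt i j a y) = swapFun a b i j y := by
  funext c
  simp only [flipAt, swapFun, Function.update_apply, ha, hb]
  by_cases hcb : c = b
  · simp [hcb, hab.symm]
  · by_cases hca : c = a <;> simp [hca, hcb, hab]

/-- A double flip is undone by a second one, which is a jump or a swap and so preserves evenness.
Hence lifts stay supported on even configurations. -/
theorem even_of_even_flipAt_flipAt {n N : ℕ} {i j : Fin N} {a b : Fin n} (hab : a ≠ b)
    {y : Fin n → Fin N} (ha : y a = i ∨ y a = j) (hb : y b = i ∨ y b = j)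
    (hy : ∀ k, Even (occ (flipAt i j b (flipAt i j a y)) k)) (k : Fin N) : Even (occ y k) := by
  set z := flipAt i j b (flipAt i j a y) with hz
  have hyz : y = flipAt i j b (flipAt i j a z) := by
    rw [hz, flipAt_comm i j hab, flipAt_flipAt, flipAt_flipAt]
  have hza : z a = Equiv.swap i j (y a) := by simp [hz, flipAt, hab]
  have hzb : z b = Equiv.swap i j (y b) := by simp [hz, flipAt, hab.symm]
  rw [hyz]
  rcases ha with ha | ha <;> rcases hb with hb | hb <;>
    simp only [ha, hb, Equiv.swap_apply_left, Equiv.swap_apply_right] at hza hzb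
  · rw [flipAt_comm_sites i j b, flipAt_comm_sites i j a,
      flipAt_flipAt_eq_jumpFun i hab hza hzb]
    exact jumpFun_even _ _ _ _ _ hy k
  · rw [flipAt_comm_sites i j b, flipAt_comm_sites i j a, flipAt_flipAt_eq_swapFun hab hza hzb]
    exact swapFun_even _ _ _ _ _ hy k
  · rw [flipAt_flipAt_eq_swapFun hab hza hzb]
    exact swapFun_even _ _ _ _ _ hy k
  · rw [flipAt_flipAt_eq_jumpFun j hab hza hzb]
    exact jumpFun_even _ _ _ _ _ hy k

theorem sum_sum_eq_add_sum_offDiag {ι : Type*} [Fintype ι] [DecidableEq ι] (g : ι → ι → ℝ) :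
    ∑ a, ∑ b, g a b = ∑ a, g a a + ∑ p ∈ (Finset.univ : Finset ι).offDiag, g p.1 p.2 := by
  rw [← Finset.sum_product' Finset.univ Finset.univ g, ← Finset.diag_union_offDiag,
    Finset.sum_union (Finset.disjoint_diag_offDiag _), Finset.sum_diag]

/-- Flipping the same label twice restores `y` and yields the negative diagonal term; distinct
labels are flipped independently. -/
theorem rotGen_rotGen {n N : ℕ} {i j : Fin N} (hij : i ≠ j) (G : (Fin n → Fin N) → ℝ)
    (y : Fin n → Fin N) :
    rotGen i j (rotGen i j G) y = -((∑ a, rotSign i j (y a) ^ 2) * G y) +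
      ∑ p ∈ (Finset.univ : Finset (Fin n)).offDiag, rotSign i j (y p.1) * rotSign i j (y p.2) *
        G (flipAt i j p.2 (flipAt i j p.1 y)) := by
  have h := sum_sum_eq_add_sum_offDiag fun a b : Fin n => rotSign i j (y a) *
    (rotSign i j (flipAt i j a y b) * G (flipAt i j b (flipAt i j a y)))
  simp only [rotGen, Finset.mul_sum]
  rw [h, Finset.sum_mul, ← Finset.sum_neg_distrib]
  congr 1
  · refine Finset.sum_congr rfl fun a _ => ?_
    rw [flipAt_flipAt, flipAt, Function.update_self, rotSign_swap hij]
    ring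
  · refine Finset.sum_congr rfl fun p hp => ?_
    have hne : p.2 ≠ p.1 := (Finset.mem_offDiag.1 hp).2.2.symm
    have : flipAt i j p.1 y p.2 = y p.2 := by rw [flipAt, Function.update_of_ne hne]
    rw [this, mul_assoc]

theorem rotSign_eq_zero {N : ℕ} {i j k : Fin N} (h : ¬(k = i ∨ k = j)) : rotSign i j k = 0 := by
  rw [not_or] at h
  rw [rotSign, if_neg h.1, if_neg h.2]

theorem sum_ite_eq_occ {n N : ℕ} (y : Fin n → Fin N) (i : Fin N) :
    ∑ a, (if y a = i then (1 : ℝ) else 0) = occ y i := by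
  rw [occ, Finset.card_filter]
  push_cast
  rfl

theorem sum_rotSign_sq {n N : ℕ} {i j : Fin N} (hij : i ≠ j) (y : Fin n → Fin N) :
    ∑ a, rotSign i j (y a) ^ 2 = occ y i + occ y j := by
  rw [← sum_ite_eq_occ, ← sum_ite_eq_occ, ← Finset.sum_add_distrib]
  refine Finset.sum_congr rfl fun a _ => ?_
  unfold rotSign
  split_ifs <;> simp_all

theorem sum_offDiag_ite {n N : ℕ} (y : Fin n → Fin N) (i j : Fin N) :
    ∑ p ∈ (Finset.univ : Finset (Fin n)).offDiag,
      (if y p.1 = i ∧ y p.2 = j then (1 : ℝ) else 0) =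
      occ y i * occ y j - if i = j then (occ y i : ℝ) else 0 := by
  have h := sum_sum_eq_add_sum_offDiag fun a b : Fin n =>
    if y a = i ∧ y b = j then (1 : ℝ) else 0
  have h1 : ∑ a, ∑ b, (if y a = i ∧ y b = j then (1 : ℝ) else 0) = occ y i * occ y j := by
    rw [← sum_ite_eq_occ, ← sum_ite_eq_occ, Finset.sum_mul_sum]
    refine Finset.sum_congr rfl fun a _ => Finset.sum_congr rfl fun b _ => ?_
    rw [ite_and]
    split_ifs <;> simp
  have h2 : ∑ a, (if y a = i ∧ y a = j then (1 : ℝ) else 0) =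
      if i = j then (occ y i : ℝ) else 0 := by
    split_ifs with hij
    · subst hij
      simp only [and_self, sum_ite_eq_occ]
    · exact Finset.sum_eq_zero fun a _ => if_neg fun hh => hij (hh.1.symm.trans hh.2)
  rw [h1, h2] at h
  linarith

theorem occ_jumpFun {n N : ℕ} {i : Fin N} (j : Fin N) {a b : Fin n} (hab : a ≠ b)
    {y : Fin n → Fin N} (ha : y a = i) (hb : y b = i) (k : Fin N) :
    occ (jumpFun a b i j y) k + (if i = k then 2 else 0) =
      occ y k + (if j = k then 2 else 0) := by
  have hR : ∑ c ∈ (Finset.univ.erase a).erase b, (if jumpFun a b i j y c = k then 1 else 0)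
      = ∑ c ∈ (Finset.univ.erase a).erase b, (if y c = k then 1 else 0) := by
    refine Finset.sum_congr rfl fun c hc => ?_
    simp only [Finset.mem_erase] at hc
    simp [jumpFun, hc.1, hc.2.1]
  have ha' : jumpFun a b i j y a = j := by simp [jumpFun, ha, hb, hab]
  have hb' : jumpFun a b i j y b = j := by simp [jumpFun, ha, hb, hab]
  rw [occ_eq_sum _ k hab, occ_eq_sum y k hab, hR, ha, hb, ha', hb']
  split_ifs <;> omega

theorem occ_swapFun {n N : ℕ} {i j : Fin N} {a b : Fin n} (hab : a ≠ b)
    {y : Fin n → Fin N} (ha : y a = i) (hb : y b = j) (k : Fin N) :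
    occ (swapFun a b i j y) k = occ y k := by
  have hR : ∑ c ∈ (Finset.univ.erase a).erase b, (if swapFun a b i j y c = k then 1 else 0)
      = ∑ c ∈ (Finset.univ.erase a).erase b, (if y c = k then 1 else 0) := by
    refine Finset.sum_congr rfl fun c hc => ?_
    simp only [Finset.mem_erase] at hc
    simp [swapFun, hc.1, hc.2.1]
  have ha' : swapFun a b i j y a = j := by simp [swapFun, ha, hb]
  have hb' : swapFun a b i j y b = i := by simp [swapFun, ha, hb, hab.symm]
  rw [occ_eq_sum _ k hab, occ_eq_sum y k hab, hR, ha, hb, ha', hb']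
  omega

theorem siteMatchings_swapFun {n N : ℕ} {i j : Fin N} {a b : Fin n} (hab : a ≠ b)
    {y : Fin n → Fin N} (ha : y a = i) (hb : y b = j) :
    siteMatchings (swapFun a b i j y) = siteMatchings y :=
  Finset.prod_congr rfl fun k _ => by rw [occ_swapFun hab ha hb]

/-- The jump divides `n_i!!` by `n_i - 1` and multiplies `n_j!!` by `n_j + 1`. The resulting ratio
is the prefactor of `moveOp`. -/
theorem siteMatchings_jumpFun {n N : ℕ} {i j : Fin N} (hij : i ≠ j) {a b : Fin n} (hab : a ≠ b)
    {y : Fin n → Fin N} (ha : y a = i) (hb : y b = i) :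
    (siteMatchings (jumpFun a b i j y) : ℝ) * ((occ y i : ℝ) - 1) =
      siteMatchings y * ((occ y j : ℝ) + 1) := by
  have hj : j ∈ (Finset.univ.erase i : Finset (Fin N)) := by simp [hij.symm]
  have hocc := occ_jumpFun j hab ha hb
  have hi' := hocc i
  have hj' := hocc j
  simp only [if_true, if_neg hij, if_neg hij.symm, add_zero] at hi' hj'
  have hR : ∏ k ∈ (Finset.univ.erase i).erase j, matchings (occ (jumpFun a b i j y) k) =
      ∏ k ∈ (Finset.univ.erase i).erase j, matchings (occ y k) := by
    refine Finset.prod_congr rfl fun k hk => ?_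
    simp only [Finset.mem_erase, Finset.mem_univ, and_true] at hk
    have hk' := hocc k
    rw [if_neg (Ne.symm hk.2), if_neg (Ne.symm hk.1)] at hk'
    rw [← add_zero (occ y k), ← hk', add_zero]
  simp only [siteMatchings]
  rw [← Finset.mul_prod_erase _ _ (Finset.mem_univ i), ← Finset.mul_prod_erase _ _ hj,
    ← Finset.mul_prod_erase _ (fun k => matchings (occ y k)) (Finset.mem_univ i),
    ← Finset.mul_prod_erase _ (fun k => matchings (occ y k)) hj, hR, hj', ← hi']
  simp only [matchings]
  push_cast
  ring

/-- The tensor `∏ n_i(y)!! f(y)`, extended by zero to all configurations. -/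
def lift {n N : ℕ} (f : EvenConfig n N → ℝ) (y : Fin n → Fin N) : ℝ :=
  if h : ∀ k, Even (occ y k) then siteMatchings y * f ⟨y, h⟩ else 0

theorem lift_coe {n N : ℕ} (f : EvenConfig n N → ℝ) (y : EvenConfig n N) :
    lift f y.1 = siteMatchings y.1 * f y := dif_pos y.2

theorem lift_of_not {n N : ℕ} (f : EvenConfig n N → ℝ) {y : Fin n → Fin N}
    (h : ¬∀ k, Even (occ y k)) : lift f y = 0 := dif_neg h

theorem occ_sub_one_ne_zero {n N : ℕ} (y : EvenConfig n N) (i : Fin N) :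
    (occ y.1 i : ℝ) - 1 ≠ 0 := by
  intro h
  have h1 : occ y.1 i = 1 := by
    have : (occ y.1 i : ℝ) = (1 : ℕ) := by push_cast; linarith
    exact_mod_cast this
  have := y.2 i
  rw [h1] at this
  exact absurd this (by decide)

theorem lift_jumpFun {n N : ℕ} {i j : Fin N} (hij : i ≠ j) {a b : Fin n} (hab : a ≠ b)
    (f : EvenConfig n N → ℝ) {y : EvenConfig n N} (ha : y.1 a = i) (hb : y.1 b = i) :
    lift f (jumpFun a b i j y.1) =
      siteMatchings y.1 * (((occ y.1 j : ℝ) + 1) / ((occ y.1 i : ℝ) - 1)) *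
        f (jump a b i j y) := by
  have h0 := occ_sub_one_ne_zero y i
  have h := lift_coe f (jump a b i j y)
  have hm := siteMatchings_jumpFun hij hab ha hb
  rw [show (jump a b i j y).1 = jumpFun a b i j y.1 from rfl] at h
  rw [h, ← mul_div_assoc, ← hm, mul_div_assoc, div_self h0, mul_one]

theorem sum_jump_sub {n N : ℕ} (i j : Fin N) (f : EvenConfig n N → ℝ) (y : EvenConfig n N) :
    ∑ p ∈ (Finset.univ : Finset (Fin n)).offDiag, (f (jump p.1 p.2 i j y) - f y) =
      ∑ p ∈ (Finset.univ : Finset (Fin n)).offDiag,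
        (if y.1 p.1 = i ∧ y.1 p.2 = i then f (jump p.1 p.2 i j y) else 0) -
      f y * (occ y.1 i * ((occ y.1 i : ℝ) - 1)) := by
  have h := sum_offDiag_ite y.1 i i
  rw [if_pos rfl] at h
  rw [mul_sub_one, ← h, Finset.mul_sum, ← Finset.sum_sub_distrib]
  refine Finset.sum_congr rfl fun p _ => ?_
  split_ifs with hp
  · ring
  · have : jump p.1 p.2 i j y = y := Subtype.ext (funext fun c =>
      if_neg fun hc => hp hc.2.2)
    rw [this]
    ring

theorem sum_swap_sub {n N : ℕ} {i j : Fin N} (hij : i ≠ j) (f : EvenConfig n N → ℝ)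
    (y : EvenConfig n N) :
    ∑ p ∈ (Finset.univ : Finset (Fin n)).offDiag, (f (swap p.1 p.2 i j y) - f y) =
      ∑ p ∈ (Finset.univ : Finset (Fin n)).offDiag,
        (if y.1 p.1 = i ∧ y.1 p.2 = j then f (swap p.1 p.2 i j y) else 0) -
      f y * (occ y.1 i * occ y.1 j) := by
  have h := sum_offDiag_ite y.1 i j
  rw [if_neg hij, sub_zero] at h
  rw [← h, Finset.mul_sum, ← Finset.sum_sub_distrib]
  refine Finset.sum_congr rfl fun p _ => ?_
  split_ifs with hp
  · ring
  · have : swap p.1 p.2 i j y = y := Subtype.ext (funext fun c => by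
      simp only [swap, swapFun, hp, and_false, if_false])
    rw [this]
    ring

/-- Two labels at the same site jump together, with sign `+`; labels at opposite sites swap, with
sign `-`. A label at neither site makes every term vanish. -/
theorem rotSign_mul_lift {n N : ℕ} {i j : Fin N} (hij : i ≠ j) (f : EvenConfig n N → ℝ)
    (y : EvenConfig n N) {a b : Fin n} (hab : a ≠ b) :
    rotSign i j (y.1 a) * rotSign i j (y.1 b) * lift f (flipAt i j b (flipAt i j a y.1)) =
      siteMatchings y.1 * (((occ y.1 j : ℝ) + 1) / ((occ y.1 i : ℝ) - 1)) *
        (if y.1 a = i ∧ y.1 b = i then f (jump a b i j y) else 0) +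
      siteMatchings y.1 * (((occ y.1 i : ℝ) + 1) / ((occ y.1 j : ℝ) - 1)) *
        (if y.1 a = j ∧ y.1 b = j then f (jump a b j i y) else 0) -
      siteMatchings y.1 * (if y.1 a = i ∧ y.1 b = j then f (swap a b i j y) else 0) -
      siteMatchings y.1 * (if y.1 b = i ∧ y.1 a = j then f (swap b a i j y) else 0) := by
  have hswap : ∀ {a b : Fin n}, a ≠ b → y.1 a = i → y.1 b = j →
      lift f (swapFun a b i j y.1) = siteMatchings y.1 * f (swap a b i j y) := by
    intro a b hab ha hb
    rw [← siteMatchings_swapFun hab ha hb]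
    exact lift_coe f (swap a b i j y)
  by_cases ha : y.1 a = i ∨ y.1 a = j
  swap
  · rw [rotSign_eq_zero ha]
    rw [not_or] at ha
    simp [ha.1, ha.2]
  by_cases hb : y.1 b = i ∨ y.1 b = j
  swap
  · rw [rotSign_eq_zero hb]
    rw [not_or] at hb
    simp [hb.1, hb.2]
  rcases ha with ha | ha <;> rcases hb with hb | hb
  · rw [flipAt_flipAt_eq_jumpFun j hab ha hb, lift_jumpFun hij hab f ha hb]
    simp [rotSign, ha, hb, hij]
  · rw [flipAt_flipAt_eq_swapFun hab ha hb, hswap hab ha hb]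
    simp [rotSign, ha, hb, hij, hij.symm]
  · rw [flipAt_comm i j hab, flipAt_flipAt_eq_swapFun hab.symm hb ha, hswap hab.symm hb ha]
    simp [rotSign, ha, hb, hij, hij.symm]
  · rw [flipAt_comm_sites i j b, flipAt_comm_sites i j a, flipAt_flipAt_eq_jumpFun i hab ha hb,
      lift_jumpFun hij.symm hab f ha hb]
    simp [rotSign, ha, hb, hij.symm]

/-- The generator is conjugate to the square of the infinitesimal rotation. -/
theorem rotGen_rotGen_lift {n N : ℕ} {i j : Fin N} (hij : i ≠ j) (f : EvenConfig n N → ℝ) :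
    rotGen i j (rotGen i j (lift f)) = lift fun y => moveOp i j f y - exchOp i j f y := by
  funext y
  rw [rotGen_rotGen hij]
  by_cases hy : ∀ k, Even (occ y k)
  swap
  · rw [lift_of_not _ hy, lift_of_not _ hy, mul_zero, neg_zero, zero_add]
    refine Finset.sum_eq_zero fun p hp => ?_
    have hne : p.1 ≠ p.2 := (Finset.mem_offDiag.1 hp).2.2
    by_cases h1 : y p.1 = i ∨ y p.1 = j
    swap
    · rw [rotSign_eq_zero h1, zero_mul, zero_mul]
    by_cases h2 : y p.2 = i ∨ y p.2 = j
    swap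
    · rw [rotSign_eq_zero h2, mul_zero, zero_mul]
    rw [lift_of_not _ fun h => hy (even_of_even_flipAt_flipAt hne h1 h2 h), mul_zero]
  lift y to EvenConfig n N using hy
  rw [Finset.sum_congr rfl fun p hp => rotSign_mul_lift hij f y (Finset.mem_offDiag.1 hp).2.2]
  simp only [Finset.sum_sub_distrib, Finset.sum_add_distrib, ← Finset.mul_sum]
  -- Both orders of a pair give the same swap sum, which accounts for the factor `2` in `exchOp`.
  have hsymm : ∑ p ∈ (Finset.univ : Finset (Fin n)).offDiag,
      (if y.1 p.2 = i ∧ y.1 p.1 = j then f (swap p.2 p.1 i j y) else 0) =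
      ∑ p ∈ (Finset.univ : Finset (Fin n)).offDiag,
        (if y.1 p.1 = i ∧ y.1 p.2 = j then f (swap p.1 p.2 i j y) else 0) :=
    Finset.sum_bij' (fun p _ => p.swap) (fun p _ => p.swap)
      (fun p hp => by simpa [eq_comm] using hp) (fun p hp => by simpa [eq_comm] using hp)
      (fun _ _ => rfl) (fun _ _ => rfl) (fun _ _ => rfl)
  rw [lift_coe, lift_coe, hsymm, sum_rotSign_sq hij, moveOp, exchOp, sum_jump_sub, sum_jump_sub,
    sum_swap_sub hij]
  -- The diagonal terms agree: `-(n_j + 1) n_i - (n_i + 1) n_j + 2 n_i n_j = -(n_i + n_j)`.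
  have hi := occ_sub_one_ne_zero y i
  have hj := occ_sub_one_ne_zero y j
  field_simp
  ring

/-! ### The maximum principle -/

theorem hasDerivAt_nonneg_of_le_left {g : ℝ → ℝ} {g' a x : ℝ} (hg : HasDerivAt g g' x)
    (hax : a < x) (hle : ∀ s ∈ Set.Icc a x, g s ≤ g x) : 0 ≤ g' := by
  by_contra! hneg
  have h1 : ∀ᶠ s in nhdsWithin x (Set.Iio x), slope g x s < 0 :=
    ((hasDerivAt_iff_tendsto_slope.1 hg).eventually_lt_const hneg).filter_mono
      (nhdsWithin_mono _ fun s hs => ne_of_lt hs)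
  obtain ⟨s, hs, hsI⟩ := (h1.and (Ioo_mem_nhdsLT hax)).exists
  rw [slope_def_field] at hs
  have := hle s ⟨hsI.1.le, hsI.2.le⟩
  exact absurd hs (not_lt.2 (div_nonneg_of_nonpos (by linarith) (by linarith [hsI.2])))

/-- The factor `1` gives the outer sum the weighted form to which `rotPairing_sum` applies. -/
theorem lift_generator {n N : ℕ} (c : Fin N → Fin N → ℝ) (f : EvenConfig n N → ℝ) :
    lift (generator c f) = fun y => ∑ i : Fin N, 1 * ∑ j ∈ Finset.univ.filter (fun j => i < j),
      c i j * rotGen i j (rotGen i j (lift f)) y := by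
  have h : ∀ (i : Fin N) y, ∑ j ∈ Finset.univ.filter (fun j => i < j),
      c i j * rotGen i j (rotGen i j (lift f)) y =
      ∑ j ∈ Finset.univ.filter (fun j => i < j),
        c i j * lift (fun z => moveOp i j f z - exchOp i j f z) y := fun i y =>
    Finset.sum_congr rfl fun j hj => by
      rw [rotGen_rotGen_lift (ne_of_lt (Finset.mem_filter.1 hj).2)]
  funext y
  simp only [h, one_mul]
  by_cases hy : ∀ k, Even (occ y k)
  · lift y to EvenConfig n N using hy
    simp only [lift_coe, generator, Finset.mul_sum]
    exact Finset.sum_congr rfl fun i _ => Finset.sum_congr rfl fun j _ => by ring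
  · simp [lift_of_not _ hy]

theorem rotPairing_lift_generator {n N : ℕ} (c : Fin N → Fin N → ℝ) (f : EvenConfig n N → ℝ)
    (W : (Fin n → Fin N) → ℝ) (O : Fin N → Fin N → ℝ) :
    rotPairing W (lift (generator c f)) O =
      ∑ i : Fin N, ∑ j ∈ Finset.univ.filter (fun j => i < j),
        c i j * rotPairing W (rotGen i j (rotGen i j (lift f))) O := by
  rw [lift_generator, rotPairing_sum]
  simp only [one_mul, rotPairing_sum]

theorem hasDerivAt_lift {n N : ℕ} {h : ℝ → EvenConfig n N → ℝ} {h' : EvenConfig n N → ℝ} {s : ℝ}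
    (hh : ∀ x, HasDerivAt (fun r => h r x) (h' x) s) (y : Fin n → Fin N) :
    HasDerivAt (fun r => lift (h r) y) (lift h' y) s := by
  by_cases hy : ∀ k, Even (occ y k)
  · simp only [lift, dif_pos hy]
    exact (hh _).const_mul _
  · simp only [lift, dif_neg hy]
    exact hasDerivAt_const _ _

theorem continuousOn_lift {n N : ℕ} {h : ℝ → EvenConfig n N → ℝ} {S : Set ℝ}
    (hh : ∀ x, ContinuousOn (fun r => h r x) S) (y : Fin n → Fin N) :
    ContinuousOn (fun r => lift (h r) y) S := by
  by_cases hy : ∀ k, Even (occ y k)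
  · simp only [lift, dif_pos hy]
    exact continuousOn_const.mul (hh _)
  · simp only [lift, dif_neg hy]
    exact continuousOn_const

theorem continuousOn_rotPairing_lift {n N : ℕ} {h : ℝ → EvenConfig n N → ℝ} {S : Set ℝ}
    (hh : ∀ x, ContinuousOn (fun r => h r x) S) (W : (Fin n → Fin N) → ℝ)
    (T : Set (Fin N → Fin N → ℝ)) :
    ContinuousOn (fun p : ℝ × (Fin N → Fin N → ℝ) => rotPairing W (lift (h p.1)) p.2)
      (S ×ˢ T) := by
  refine continuousOn_finsetSum _ fun x _ => continuousOn_const.mul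
    (continuousOn_finsetSum _ fun y _ => ContinuousOn.mul (Continuous.continuousOn ?_) ?_)
  · fun_prop
  · exact (continuousOn_lift hh y).comp continuousOn_fst fun p hp => hp.1

/-- Maximum principle: the flow does not increase the maximum over all rotations of the pairing
with a fixed tensor. -/
theorem IsFlowSolution.rotPairing_le {n N : ℕ} {c : Fin N → Fin N → ℝ → ℝ} {s₁ s₂ : ℝ}
    (hs : s₁ ≤ s₂) (hc : ∀ i j, i < j → ∀ s ∈ Set.Ioo s₁ s₂, 0 ≤ c i j s)
    {f : EvenConfig n N → ℝ} {h : ℝ → EvenConfig n N → ℝ} (hh : IsFlowSolution c s₁ s₂ f h)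
    {W : (Fin n → Fin N) → ℝ} {C : ℝ}
    (hC : ∀ O ∈ orthonormalColumns N, rotPairing W (lift f) O ≤ C)
    {O : Fin N → Fin N → ℝ} (hO : O ∈ orthonormalColumns N) :
    rotPairing W (lift (h s₂)) O ≤ C := by
  rcases hs.eq_or_lt with rfl | hlt
  · rw [hh.initial]
    exact hC O hO
  have hcont := continuousOn_rotPairing_lift hh.continuousOn W (orthonormalColumns N)
  -- The equation holds only at interior times, so `s₂` is reached by continuity at the end.
  have main : ∀ t ∈ Set.Ico s₁ s₂, rotPairing W (lift (h t)) O ≤ C := by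
    intro t ht
    refine le_of_forall_pos_le_add fun δ hδ => ?_
    -- The penalty `ε (r - s₁)` forces strict growth at a maximum after `s₁`, while costing at most
    -- `δ` at time `t`.
    obtain ⟨ε, hε, hεδ⟩ : ∃ ε > 0, ε * (t - s₁) ≤ δ := by
      refine ⟨δ / (t - s₁ + 1), div_pos hδ (by linarith [ht.1]), ?_⟩
      rw [div_mul_eq_mul_div, div_le_iff₀ (by linarith [ht.1])]
      nlinarith
    have hK : IsCompact (Set.Icc s₁ t ×ˢ orthonormalColumns N) :=
      isCompact_Icc.prod (isCompact_orthonormalColumns N)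
    obtain ⟨⟨s, Q⟩, hsQ, hmax⟩ := hK.exists_isMaxOn
      (f := fun p => rotPairing W (lift (h p.1)) p.2 - ε * (p.1 - s₁))
      ⟨(t, O), ⟨ht.1, le_rfl⟩, hO⟩
      ((hcont.mono (Set.prod_mono (Set.Icc_subset_Icc_right ht.2.le) subset_rfl)).sub
        (by fun_prop))
    have hsI : s ∈ Set.Icc s₁ t := hsQ.1
    have hQ : Q ∈ orthonormalColumns N := hsQ.2
    have hmax' : ∀ r ∈ Set.Icc s₁ t, ∀ P ∈ orthonormalColumns N,
        rotPairing W (lift (h r)) P - ε * (r - s₁) ≤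
          rotPairing W (lift (h s)) Q - ε * (s - s₁) := fun r hr P hP =>
      hmax (a := (r, P)) ⟨hr, hP⟩
    rcases hsI.1.eq_or_lt with hs1 | hs1
    · have h1 := hmax' t ⟨ht.1, le_rfl⟩ O hO
      rw [← hs1, hh.initial, sub_self, mul_zero, sub_zero] at h1
      linarith [hC Q hQ]
    · exfalso
      have hsI' : s ∈ Set.Ioo s₁ s₂ := ⟨hs1, hsI.2.trans_lt ht.2⟩
      -- The maximum may sit at `s = t`, so only times before `s` are compared: the time derivative
      -- is at least `ε`. Maximality in `Q` makes it nonpositive, a contradiction.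
      have hd : HasDerivAt (fun r => rotPairing W (lift (h r)) Q)
          (rotPairing W (lift (generator (fun i j => c i j s) (h s))) Q) s :=
        HasDerivAt.fun_sum fun x _ => (HasDerivAt.fun_sum fun y _ =>
          (hasDerivAt_lift (hh.hasDerivAt s hsI') y).const_mul _).const_mul _
      have hneg : rotPairing W (lift (generator (fun i j => c i j s) (h s))) Q ≤ 0 := by
        rw [rotPairing_lift_generator]
        refine Finset.sum_nonpos fun i _ => Finset.sum_nonpos fun j hj => ?_
        have hij : i < j := (Finset.mem_filter.1 hj).2
        refine mul_nonpos_of_nonneg_of_nonpos (hc i j hij s hsI')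
          (rotPairing_rotGen_rotGen_nonpos hij.ne hQ fun P hP => ?_)
        linarith [hmax' s hsI P hP]
      have hd' := hd.fun_sub (((hasDerivAt_id' s).sub_const s₁).const_mul ε)
      have := hasDerivAt_nonneg_of_le_left hd' hs1 fun r hr =>
        hmax' r ⟨hr.1, hr.2.trans hsI.2⟩ Q hQ
      linarith
  have hcw : ContinuousWithinAt (fun s => rotPairing W (lift (h s)) O) (Set.Ico s₁ s₂) s₂ :=
    ((hcont.comp (f := fun s => (s, O)) (by fun_prop) fun s hs => ⟨hs, hO⟩) s₂
      (Set.right_mem_Icc.2 hs)).mono Set.Ico_subset_Icc_self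
  have := right_nhdsWithin_Ico_neBot hlt
  exact le_of_tendsto hcw (by filter_upwards [self_mem_nhdsWithin] with t ht using main t ht)

/-! ### The norm bound -/

theorem revMeasure_eq {n N : ℕ} (x : EvenConfig n N) :
    revMeasure x = (siteMatchings x.1 : ℝ) ^ 2 := by
  rw [revMeasure, Finset.prod_pow, siteMatchings, Nat.cast_prod]

theorem matchings_pos_of_even : ∀ {k : ℕ}, Even k → 0 < matchings k
  | 0, _ => one_pos
  | 1, h => absurd h (by decide)
  | k + 2, h => Nat.mul_pos k.succ_pos (matchings_pos_of_even (by simpa [Nat.even_add] using h))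

theorem revMeasure_pos {n N : ℕ} (x : EvenConfig n N) : 0 < revMeasure x :=
  Finset.prod_pos fun i _ => pow_pos (Nat.cast_pos.2 (matchings_pos_of_even (x.2 i))) 2

theorem sum_siteMatchings_mul_abs_lift {n N : ℕ} (f : EvenConfig n N → ℝ) :
    ∑ y, (siteMatchings y : ℝ) * |lift f y| = normL1 f := by
  refine (Fintype.sum_of_injective Subtype.val Subtype.val_injective _ _ (fun y hy => ?_)
    fun x => ?_).symm
  · rw [lift_of_not f fun h => hy ⟨⟨y, h⟩, rfl⟩, abs_zero, mul_zero]
  · rw [lift_coe, revMeasure_eq, abs_mul, Nat.abs_cast]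
    ring

theorem sum_abs_lift_le {n N : ℕ} (f : EvenConfig n N → ℝ) : ∑ y, |lift f y| ≤ normL1 f := by
  rw [← sum_siteMatchings_mul_abs_lift]
  refine Finset.sum_le_sum fun y _ => ?_
  by_cases hy : ∀ k, Even (occ y k)
  · refine le_mul_of_one_le_left (abs_nonneg _) ?_
    exact_mod_cast Finset.prod_pos fun k _ => matchings_pos_of_even (hy k)
  · simp [lift_of_not f hy]

/-- The `L¹` bound for solutions of the flow. -/
theorem IsFlowSolution.normL1_le {n N : ℕ} {c : Fin N → Fin N → ℝ → ℝ} {s₁ s₂ : ℝ}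
    (hs : s₁ ≤ s₂) (hc : ∀ i j, i < j → ∀ s ∈ Set.Ioo s₁ s₂, 0 ≤ c i j s)
    {f : EvenConfig n N → ℝ} {h : ℝ → EvenConfig n N → ℝ} (hh : IsFlowSolution c s₁ s₂ f h) :
    normL1 (h s₂) ≤ matchings n * normL1 f := by
  -- This `W` is dual to the final state: its pairing with `lift (h s₂)` at the identity matrix is
  -- `normL1 (h s₂)`.
  set W : (Fin n → Fin N) → ℝ := fun x => siteMatchings x * SignType.sign (lift (h s₂) x)
  have hW : ∀ x, |W x| ≤ siteMatchings x := by
    intro x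
    rw [abs_mul, Nat.abs_cast]
    refine mul_le_of_le_one_right (Nat.cast_nonneg _) ?_
    rcases SignType.trichotomy (SignType.sign (lift (h s₂) x)) with h | h | h <;> simp [h]
  have h1 := hh.rotPairing_le hs hc (W := W) (C := matchings n * normL1 f)
    (fun O hO => (ColoredFlow.rotPairing_le hW hO).trans
      (mul_le_mul_of_nonneg_left (sum_abs_lift_le f) (Nat.cast_nonneg _)))
    (O := fun r k => if r = k then 1 else 0) (fun k l => by simp [eq_comm])
  rw [rotPairing_one] at h1
  rw [← sum_siteMatchings_mul_abs_lift]
  refine le_of_eq_of_le (Finset.sum_congr rfl fun x _ => ?_) h1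
  simp only [W]
  rw [mul_assoc, sign_mul_self]

/-! ### Linearity, uniqueness and existence of solutions -/

/-- The contribution of the sites `i` and `j` to the generator, as a linear map. -/
noncomputable def sitePairGenerator {n N : ℕ} (i j : Fin N) :
    (EvenConfig n N → ℝ) →ₗ[ℝ] (EvenConfig n N → ℝ) where
  toFun f x := moveOp i j f x - exchOp i j f x
  map_add' f g := by
    funext x
    simp only [moveOp, exchOp, Pi.add_apply, Finset.sum_sub_distrib, Finset.sum_add_distrib]
    ring
  map_smul' r f := by
    funext x
    simp only [moveOp, exchOp, Pi.smul_apply, smul_eq_mul, Finset.sum_sub_distrib,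
      ← Finset.mul_sum, RingHom.id_apply]
    ring

/-- The generator as a continuous linear map. -/
noncomputable def generatorCLM {n N : ℕ} (c : Fin N → Fin N → ℝ) :
    (EvenConfig n N → ℝ) →L[ℝ] (EvenConfig n N → ℝ) :=
  ∑ i : Fin N, ∑ j ∈ Finset.univ.filter (fun j => i < j),
    c i j • LinearMap.toContinuousLinearMap (sitePairGenerator i j)

theorem generatorCLM_apply {n N : ℕ} (c : Fin N → Fin N → ℝ) (f : EvenConfig n N → ℝ) :
    generatorCLM c f = generator c f := by
  funext x
  simp [generatorCLM, generator, sitePairGenerator, Finset.sum_apply]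

theorem IsFlowSolution.add_smul {n N : ℕ} {c : Fin N → Fin N → ℝ → ℝ} {s₁ s₂ : ℝ}
    {f g : EvenConfig n N → ℝ} {h k : ℝ → EvenConfig n N → ℝ} (hh : IsFlowSolution c s₁ s₂ f h)
    (hk : IsFlowSolution c s₁ s₂ g k) (r : ℝ) :
    IsFlowSolution c s₁ s₂ (f + r • g) fun s => h s + r • k s where
  continuousOn x := (hh.continuousOn x).add ((hk.continuousOn x).const_smul r)
  initial := by rw [hh.initial, hk.initial]
  hasDerivAt s hs x := by
    rw [← generatorCLM_apply, map_add, map_smul, generatorCLM_apply, generatorCLM_apply]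
    exact (hh.hasDerivAt s hs x).add ((hk.hasDerivAt s hs x).const_smul r)

/-- The difference starts from zero, so its final norm vanishes, and `π` is strictly positive. No
continuity of the coefficients is needed. -/
theorem IsFlowSolution.unique {n N : ℕ} {c : Fin N → Fin N → ℝ → ℝ} {s₁ s₂ : ℝ}
    (hs : s₁ ≤ s₂) (hc : ∀ i j, i < j → ∀ s ∈ Set.Ioo s₁ s₂, 0 ≤ c i j s)
    {f : EvenConfig n N → ℝ} {h k : ℝ → EvenConfig n N → ℝ} (hh : IsFlowSolution c s₁ s₂ f h)
    (hk : IsFlowSolution c s₁ s₂ f k) : h s₂ = k s₂ := by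
  have h1 := (hh.add_smul hk (-1)).normL1_le hs hc
  have h0 : f + (-1 : ℝ) • f = 0 := by simp
  rw [h0] at h1
  have h2 : normL1 (h s₂ + (-1 : ℝ) • k s₂) ≤ 0 := by simpa [normL1] using h1
  have h3 : ∀ x ∈ Finset.univ, 0 ≤ revMeasure x * |(h s₂ + (-1 : ℝ) • k s₂) x| := fun x _ =>
    mul_nonneg (revMeasure_pos x).le (abs_nonneg _)
  funext x
  have h4 := (Finset.sum_eq_zero_iff_of_nonneg h3).1
    (le_antisymm h2 (Finset.sum_nonneg h3)) x (Finset.mem_univ x)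
  have h5 := abs_eq_zero.1 ((mul_eq_zero.1 h4).resolve_left (revMeasure_pos x).ne')
  simp at h5
  linarith

/-- Solutions of linear differential equations with continuous coefficients exist globally. -/
theorem exists_hasDerivWithinAt_linear {ι : Type*} [Fintype ι] {a b : ℝ} (hab : a ≤ b)
    {A : ℝ → (ι → ℝ) →L[ℝ] (ι → ℝ)} (hA : ContinuousOn A (Set.Icc a b)) (x₀ : ι → ℝ) :
    ∃ h : ℝ → ι → ℝ, h a = x₀ ∧
      ∀ t ∈ Set.Icc a b, HasDerivWithinAt h (A t (h t)) (Set.Icc a b) t := by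
  obtain ⟨M, hM⟩ := isCompact_Icc.exists_bound_of_continuousOn hA
  have hM0 : 0 ≤ M := (norm_nonneg _).trans (hM a (Set.left_mem_Icc.2 hab))
  -- `R` is the Gronwall bound on the whole interval. Clamping coordinates to `[-R, R]` bounds the
  -- vector field by `M * R`, so Picard-Lindelöf reaches time `b`; Gronwall then shows that the
  -- clamp never acts.
  set R : ℝ := ‖x₀‖ * Real.exp (M * (b - a)) with hR
  have hR0 : 0 ≤ R := by positivity
  set clamp : (ι → ℝ) → ι → ℝ := fun x i => max (-R) (min R (x i)) with hclamp
  have hclamp_R : ∀ x, ‖clamp x‖ ≤ R := fun x =>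
    (pi_norm_le_iff_of_nonneg hR0).2 fun i =>
      abs_le.2 ⟨le_max_left _ _, max_le (by linarith) (min_le_left _ _)⟩
  have hclamp_norm : ∀ x, ‖clamp x‖ ≤ ‖x‖ := fun x =>
    (pi_norm_le_iff_of_nonneg (norm_nonneg x)).2 fun i => by
      refine le_trans ?_ (norm_le_pi_norm x i)
      simp only [Real.norm_eq_abs, hclamp]
      rcases abs_cases (x i) with ⟨h1, h2⟩ | ⟨h1, h2⟩ <;> rw [h1, abs_le] <;>
        constructor <;> simp only [le_max_iff, max_le_iff, min_le_iff, le_min_iff] <;> grind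
  have hclamp_eq : ∀ x, ‖x‖ ≤ R → clamp x = x := fun x hx => funext fun i => by
    have := abs_le.1 ((norm_le_pi_norm x i).trans hx)
    simp only [hclamp]
    rw [min_eq_right this.2, max_eq_right this.1]
  have hclamp_lip : ∀ x y, ‖clamp x - clamp y‖ ≤ ‖x - y‖ := fun x y =>
    (pi_norm_le_iff_of_nonneg (norm_nonneg _)).2 fun i =>
      (abs_max_sub_max_le_max (-R) _ (-R) _).trans <| max_le (by simp) <|
        (abs_min_sub_min_le_max R _ R _).trans <| max_le (by simp) (norm_le_pi_norm (x - y) i)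
  have hPL : IsPicardLindelof (fun t x => A t (clamp x)) (tmin := a) (tmax := b)
      ⟨a, Set.left_mem_Icc.2 hab⟩ x₀ ⟨M * R * (b - a), by
        have := sub_nonneg.2 hab; positivity⟩ 0 ⟨M * R, by positivity⟩ ⟨M, hM0⟩ := by
    constructor
    · intro t ht
      refine LipschitzOnWith.of_dist_le_mul fun x _ y _ => ?_
      rw [dist_eq_norm, dist_eq_norm, ← map_sub]
      exact (A t).le_of_opNorm_le_of_le (hM t ht) (hclamp_lip x y)
    · intro x _
      exact hA.clm_apply continuousOn_const
    · intro t ht x _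
      exact (A t).le_of_opNorm_le_of_le (hM t ht) (hclamp_R x)
    · simp only [NNReal.coe_zero, sub_self, sub_zero, max_eq_left (sub_nonneg.2 hab)]
      exact le_rfl
  obtain ⟨h, h0, hd⟩ := hPL.exists_eq_forall_mem_Icc_hasDerivWithinAt₀
  refine ⟨h, h0, fun t ht => ?_⟩
  have hbound := norm_le_gronwallBound_of_norm_deriv_right_le (f := h)
    (f' := fun t => A t (clamp (h t))) (δ := ‖x₀‖) (K := M) (ε := 0) (a := a) (b := b)
    (fun t ht => (hd t ht).continuousWithinAt)
    (fun t ht => (hd t (Set.Ico_subset_Icc_self ht)).mono_of_mem_nhdsWithin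
      (Icc_mem_nhdsGE_of_mem ht))
    (by rw [show h a = x₀ from h0])
    (fun t ht => by
      rw [add_zero]
      exact (A t).le_of_opNorm_le_of_le (hM t (Set.Ico_subset_Icc_self ht)) (hclamp_norm _))
    t ht
  rw [gronwallBound_ε0] at hbound
  have hle : ‖h t‖ ≤ R := hbound.trans (by
    rw [hR]
    have := ht.2
    gcongr)
  have := hd t ht
  rwa [hclamp_eq _ hle] at this

theorem exists_isFlowSolution {n N : ℕ} {c : Fin N → Fin N → ℝ → ℝ} {s₁ s₂ : ℝ} (hs : s₁ ≤ s₂)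
    (hc : ∀ i j, i < j → ContinuousOn (c i j) (Set.Icc s₁ s₂)) (f : EvenConfig n N → ℝ) :
    ∃ h, IsFlowSolution c s₁ s₂ f h := by
  have hA : ContinuousOn (fun s => generatorCLM (n := n) fun i j => c i j s)
      (Set.Icc s₁ s₂) :=
    continuousOn_finsetSum _ fun i _ => continuousOn_finsetSum _ fun j hj =>
      (hc i j (Finset.mem_filter.1 hj).2).smul continuousOn_const
  obtain ⟨h, h0, hd⟩ := exists_hasDerivWithinAt_linear hs hA f
  refine ⟨h, fun x s hsI => ?_, h0, fun s hsI x => ?_⟩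
  · exact ((hasDerivWithinAt_pi.1 (hd s hsI)) x).continuousWithinAt
  · have := (hd s (Set.Ioo_subset_Icc_self hsI)).hasDerivAt (Icc_mem_nhds hsI.1 hsI.2)
    rw [generatorCLM_apply] at this
    exact hasDerivAt_pi.1 this x

end ColoredFlow

/-! ### The propagator -/

theorem lemma4p2 (n N : ℕ) (c : Fin N → Fin N → ℝ → ℝ)
    (hc : ∀ i j, i < j → ∀ s, 0 ≤ s → 0 ≤ c i j s)
    (s₁ s₂ : ℝ) (hs₁ : 0 ≤ s₁) (hs : s₁ ≤ s₂) :
    ((∀ i j, i < j → ContinuousOn (c i j) (Set.Icc s₁ s₂)) →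
      ∃! U : (ColoredFlow.EvenConfig n N → ℝ) →ₗ[ℝ] (ColoredFlow.EvenConfig n N → ℝ),
        ColoredFlow.IsPropagator c s₁ s₂ U) ∧
    ∀ U : (ColoredFlow.EvenConfig n N → ℝ) →ₗ[ℝ] (ColoredFlow.EvenConfig n N → ℝ),
      ColoredFlow.IsPropagator c s₁ s₂ U →
        ColoredFlow.opNormL1 U ≤ (ColoredFlow.matchings n : ℝ≥0∞) := by
  have hc' : ∀ i j, i < j → ∀ s ∈ Set.Ioo s₁ s₂, 0 ≤ c i j s := fun i j hij s hsI =>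
    hc i j hij s (hs₁.trans hsI.1.le)
  refine ⟨fun hcont => ?_, fun U hU => iSup₂_le fun f hf => ?_⟩
  · choose h hh using ColoredFlow.exists_isFlowSolution (n := n) hs hcont
    refine ⟨{ toFun := fun f => h f s₂, map_add' := fun f g => ?_, map_smul' := fun r f => ?_ },
      fun f => ⟨h f, hh f, rfl⟩, fun U hU => LinearMap.ext fun f => ?_⟩
    · have := (hh f).add_smul (hh g) 1
      rw [one_smul] at this
      simpa using (hh (f + g)).unique hs hc' this
    · have hzero := (hh 0).add_smul (hh 0) (-1)
      rw [smul_zero, add_zero] at hzero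
      have h0 : h 0 s₂ = 0 := by simpa using (hh 0).unique hs hc' hzero
      have hr := (hh 0).add_smul (hh f) r
      rw [zero_add] at hr
      simpa [h0] using (hh (r • f)).unique hs hc' hr
    · obtain ⟨k, hk, hUk⟩ := hU f
      rw [hUk]
      exact hk.unique hs hc' (hh f)
  · obtain ⟨h, hh, hUh⟩ := hU f
    rw [hUh, ← ENNReal.ofReal_natCast]
    refine ENNReal.ofReal_le_ofReal ((hh.normL1_le hs hc').trans ?_)
    exact mul_le_of_le_one_right (Nat.cast_nonneg _) hf
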